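/- Let $H$ be a finite-dimensional semisimple Hopf algebra, with comultiplication $\Delta(h)=h_{(1)}\otimes h_{(2)}$, counit $\varepsilon$ and antipode $S$, over an algebraically closed field $\Bbbk$ whose characteristic $p$ satisfies either $p>(\dim_{\Bbbk}H)^{1/2}$ or $p=0$. Let $\Lambda\in H$ be a left integral of $H$ (that is, $h\Lambda=\varepsilon(h)\Lambda$ for all $h\in H$) and let $\lambda\in H^*$ be a right integral of $H^*$ (that is, $\lambda * f=f(1)\lambda$ for all $f\in H^*$, where $(\lambda * f)(h)=\lambda(h_{(1)})f(h_{(2)})$), normalized so that $\lambda(\Lambda)=1$. Then for every central primitive idempotent $e$ of $H$ (a nonzero central idempotent which is not the sum of two nonzero orthogonal central idempotents), $$\lambda(e)=\lambda(S(e)).$$ -/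

import Mathlib

section HopfDefs

/-- `e` is a central primitive idempotent of `R`: a nonzero central idempotent that is not the sum
of two nonzero orthogonal central idempotents. -/
structure IsCentralPrimitiveIdempotent {R : Type*} [Ring R] (e : R) : Prop where
  central : e ∈ Set.center R
  idem : IsIdempotentElem e
  ne_zero : e ≠ 0
  primitive : ∀ f g : R, f ∈ Set.center R → g ∈ Set.center R →
    IsIdempotentElem f → IsIdempotentElem g → f * g = 0 → f + g = e → f = 0 ∨ g = 0

/-- `Λ` is a left integral of `H`: `h Λ = ε(h) Λ` for all `h` in `H`. -/
def IsLeftIntegral (k : Type*) {H : Type*} [Field k] [Ring H] [Bialgebra k H] (Λ : H) : Prop :=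
  ∀ h : H, h * Λ = (Coalgebra.counit h : k) • Λ

/-- `l` is a right integral of the dual algebra `H*` (whose product is the convolution
`(f * g)(h) = f(h₁) g(h₂)`, whose unit is `ε`, and whose counit is evaluation at `1`):
`l * f = f(1) l` for all `f` in `H*`. -/
def IsDualRightIntegral {k H : Type*} [Field k] [Ring H] [Bialgebra k H] (l : H →ₗ[k] k) : Prop :=
  ∀ f : H →ₗ[k] k, WithConv.toConv l * WithConv.toConv f = WithConv.toConv (f 1 • l)

end HopfDefs

/-!
The identity comes from a trace formula. Write `λ` for the functional `l`, `S` for the antipode and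
`Δ Λ = ∑ aᵢ ⊗ bᵢ`. Invariance of `Λ` under left multiplication reads
`(1 ⊗ h) Δ Λ = (S h ⊗ 1) Δ Λ`, and applying `λ ⊗ id` gives the dual basis formula
`h = ∑ λ(S(h) aᵢ) bᵢ` (`sum_antipode_mul_smul_eq`). It has three consequences: `S` is injective,
hence bijective; the trace of an endomorphism `f` is `∑ λ(S(f bᵢ) aᵢ)`; and a functional `g` is
determined by the element `∑ g(aᵢ) bᵢ` of `H`.

By Maschke's argument, semisimplicity of `H` makes `Λ` a two-sided integral with `ε(Λ) ≠ 0`, so also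
`Δ Λ (h ⊗ 1) = Δ Λ (1 ⊗ S h)`. Comparing with the dual basis formula shows
`λ(x h) = λ(S²(h) x)`, and inserting `f = z S²(·)` in the trace formula yields
`Tr(z S²(·)) = ε(Λ) λ(S z)` for every `z` (`trace_mulLeft_comp_antipode_sq`).

For central `e` the endomorphisms `e S²(·)` and `S(e) S²(·)` are `(e ·) ∘ S ∘ S` and
`S ∘ (e ·) ∘ S`, which have the same trace. Hence `ε(Λ) λ(S e) = ε(Λ) λ(S² e) = ε(Λ) λ(e)`, and
`ε(Λ)` cancels.
-/

open Coalgebra HopfAlgebra TensorProduct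

/-! ### Invariance of the coproduct of an integral -/

section Invariance

variable {k H ι : Type*} [Field k] [Ring H] [HopfAlgebra k H]

lemma HopfAlgebra.sum_antipode_tmul_one_mul_comul {h : H} (r : Repr k h ι) :
    ∑ i ∈ r.index, (antipode k (r.left i) ⊗ₜ[k] (1 : H)) * comul (r.right i) = 1 ⊗ₜ[k] h := by
  let F : H ⊗[k] (H ⊗[k] H) →ₗ[k] H ⊗[k] H :=
    (LinearMap.mul' k H ∘ₗ (antipode k).rTensor H).rTensor H ∘ₗ
      (TensorProduct.assoc k H H H).symm.toLinearMap
  have hF (a : H) (t : H ⊗[k] H) : F (a ⊗ₜ t) = (antipode k a ⊗ₜ[k] (1 : H)) * t := by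
    induction t with
    | zero => simp
    | add x y hx hy => rw [tmul_add, map_add, hx, hy, mul_add]
    | tmul x y => simp [F]
  have hcomp : (LinearMap.mul' k H ∘ₗ (antipode k).rTensor H) ∘ₗ comul =
      Algebra.linearMap k H ∘ₗ counit := by
    rw [LinearMap.comp_assoc, HopfAlgebra.mul_antipode_rTensor_comul]
  calc _ = F (comul.lTensor H (comul h)) := by simp [← r.eq, map_sum, hF]
    _ = 1 ⊗ₜ h := by
      simp only [F, LinearMap.comp_apply, LinearEquiv.coe_coe, coassoc_symm_apply]
      rw [← LinearMap.rTensor_comp_apply, hcomp, LinearMap.rTensor_comp_apply,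
        rTensor_counit_comul]
      simp

lemma HopfAlgebra.sum_comul_mul_one_tmul_antipode {h : H} (r : Repr k h ι) :
    ∑ i ∈ r.index, comul (r.left i) * ((1 : H) ⊗ₜ[k] antipode k (r.right i)) = h ⊗ₜ[k] 1 := by
  let F : (H ⊗[k] H) ⊗[k] H →ₗ[k] H ⊗[k] H :=
    (LinearMap.mul' k H ∘ₗ (antipode k).lTensor H).lTensor H ∘ₗ
      (TensorProduct.assoc k H H H).toLinearMap
  have hF (t : H ⊗[k] H) (a : H) : F (t ⊗ₜ a) = t * ((1 : H) ⊗ₜ[k] antipode k a) := by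
    induction t with
    | zero => simp
    | add x y hx hy => rw [add_tmul, map_add, hx, hy, add_mul]
    | tmul x y => simp [F]
  have hcomp : (LinearMap.mul' k H ∘ₗ (antipode k).lTensor H) ∘ₗ comul =
      Algebra.linearMap k H ∘ₗ counit := by
    rw [LinearMap.comp_assoc, HopfAlgebra.mul_antipode_lTensor_comul]
  calc _ = F (comul.rTensor H (comul h)) := by simp [← r.eq, map_sum, hF]
    _ = h ⊗ₜ 1 := by
      simp only [F, LinearMap.comp_apply, LinearEquiv.coe_coe, coassoc_apply]
      rw [← LinearMap.lTensor_comp_apply, hcomp, LinearMap.lTensor_comp_apply,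
        lTensor_counit_comul]
      simp

lemma IsLeftIntegral.one_tmul_mul_comul {Λ : H} (hΛ : IsLeftIntegral k Λ) (h : H) :
    ((1 : H) ⊗ₜ[k] h) * comul Λ = (antipode k h ⊗ₜ[k] (1 : H)) * comul Λ := by
  have hs : ∑ i ∈ (ℛ k h).index, (counit (R := k) ((ℛ k h).right i)) • (ℛ k h).left i = h := by
    have := congr(TensorProduct.rid k H $(sum_tmul_counit_eq (R := k) (ℛ k h)))
    simpa only [map_sum, TensorProduct.rid_tmul, one_smul] using this
  rw [← sum_antipode_tmul_one_mul_comul (ℛ k h), Finset.sum_mul]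
  conv_rhs => rw [← hs]
  simp only [mul_assoc, ← Bialgebra.comul_mul, hΛ _, map_smul, map_sum, sum_tmul, Finset.sum_mul,
    mul_smul_comm, ← smul_tmul', smul_mul_assoc]

lemma comul_mul_tmul_one_of_right_integral {Λ : H}
    (hΛ : ∀ h : H, Λ * h = (counit h : k) • Λ) (h : H) :
    comul Λ * (h ⊗ₜ[k] (1 : H)) = comul Λ * ((1 : H) ⊗ₜ[k] antipode k h) := by
  rw [← sum_comul_mul_one_tmul_antipode (ℛ k h), Finset.mul_sum]
  conv_rhs => rw [← sum_counit_smul (ℛ k h)]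
  simp only [← mul_assoc, ← Bialgebra.comul_mul, hΛ _, map_smul, map_sum, tmul_sum, Finset.mul_sum,
    mul_smul_comm, tmul_smul, smul_mul_assoc]

lemma IsDualRightIntegral.sum_smul {l : H →ₗ[k] k} (hl : IsDualRightIntegral l) {x : H}
    (r : Repr k x ι) : ∑ i ∈ r.index, l (r.left i) • r.right i = l x • (1 : H) := by
  rw [← sub_eq_zero, ← Module.forall_dual_apply_eq_zero_iff k]
  intro f
  have h := congr($(hl f) x)
  rw [r.convMul_apply] at h
  have h' : ∑ i ∈ r.index, l (r.left i) * f (r.right i) = f 1 * l x := h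
  simp [h', mul_comm]

end Invariance

/-! ### The dual basis formula and the trace -/

section Trace

variable {k H ι : Type*} [Field k] [Ring H] [HopfAlgebra k H] {Λ : H} {l : H →ₗ[k] k}

/-- The elements `bᵢ` and the functionals `λ(S(·) aᵢ)`, where `Δ Λ = ∑ aᵢ ⊗ bᵢ`, behave like a
basis and its dual. -/
lemma sum_antipode_mul_smul_eq (hΛ : IsLeftIntegral k Λ) (hl : IsDualRightIntegral l)
    (hlΛ : l Λ = 1) (r : Repr k Λ ι) (h : H) :
    ∑ i ∈ r.index, l (antipode k h * r.left i) • r.right i = h := by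
  have key := congr(TensorProduct.lid k H (l.rTensor H $(hΛ.one_tmul_mul_comul h)))
  simp only [← r.eq, Finset.mul_sum, Algebra.TensorProduct.tmul_mul_tmul, map_sum, one_mul,
    LinearMap.rTensor_tmul, TensorProduct.lid_tmul] at key
  rw [← key]
  simp_rw [← mul_smul_comm]
  rw [← Finset.mul_sum, hl.sum_smul r, hlΛ, one_smul, mul_one]

lemma antipode_injective_of_integrals (hΛ : IsLeftIntegral k Λ) (hl : IsDualRightIntegral l)
    (hlΛ : l Λ = 1) : Function.Injective (antipode k : H →ₗ[k] H) := by
  intro x y hxy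
  rw [← sum_antipode_mul_smul_eq hΛ hl hlΛ (ℛ k Λ) x, hxy,
    sum_antipode_mul_smul_eq hΛ hl hlΛ (ℛ k Λ) y]

variable [Module.Finite k H]

lemma antipode_surjective_of_integrals (hΛ : IsLeftIntegral k Λ) (hl : IsDualRightIntegral l)
    (hlΛ : l Λ = 1) : Function.Surjective (antipode k : H →ₗ[k] H) :=
  LinearMap.injective_iff_surjective.mp (antipode_injective_of_integrals hΛ hl hlΛ)

/-- Two functionals on `H` agree as soon as they agree after contraction with the first tensor
factor of `Δ Λ`: by the dual basis formula `g ↦ ∑ g(aᵢ) bᵢ` is a surjection `H* → H` of spaces of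
equal dimension. -/
lemma dual_ext_of_integrals (hΛ : IsLeftIntegral k Λ) (hl : IsDualRightIntegral l)
    (hlΛ : l Λ = 1) (r : Repr k Λ ι) {f g : H →ₗ[k] k}
    (hfg : ∑ i ∈ r.index, f (r.left i) • r.right i = ∑ i ∈ r.index, g (r.left i) • r.right i) :
    f = g := by
  let φ : (H →ₗ[k] k) →ₗ[k] H :=
    ∑ i ∈ r.index, (LinearMap.applyₗ (R := k) (r.left i)).smulRight (r.right i)
  have hφ (f : H →ₗ[k] k) : φ f = ∑ i ∈ r.index, f (r.left i) • r.right i := by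
    simp [φ]
  have hsurj : Function.Surjective φ := fun h ↦
    ⟨l ∘ₗ LinearMap.mulLeft k (antipode k h), by
      simpa [hφ] using sum_antipode_mul_smul_eq hΛ hl hlΛ r h⟩
  have hdim : Module.finrank k (H →ₗ[k] k) = Module.finrank k H := Subspace.dual_finrank_eq
  exact (LinearMap.injective_iff_surjective_of_finrank_eq_finrank hdim).mpr hsurj
    (by rw [hφ, hφ, hfg])

/-- The Nakayama automorphism of the Frobenius form `l` is the square of the antipode, provided
`Λ` is a two-sided integral. -/
lemma apply_mul_eq_apply_antipode_sq_mul (hΛ : IsLeftIntegral k Λ)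
    (hΛr : ∀ h : H, Λ * h = (counit h : k) • Λ) (hl : IsDualRightIntegral l)
    (hlΛ : l Λ = 1) (x h : H) :
    l (x * h) = l (antipode k (antipode k h) * x) := by
  suffices l ∘ₗ LinearMap.mulRight k h = l ∘ₗ LinearMap.mulLeft k (antipode k (antipode k h)) from
    congr($this x)
  let r := ℛ k Λ
  refine dual_ext_of_integrals hΛ hl hlΛ r ?_
  have key := congr(TensorProduct.lid k H (l.rTensor H
    $(comul_mul_tmul_one_of_right_integral hΛr h)))
  simp only [← r.eq, Finset.sum_mul, Algebra.TensorProduct.tmul_mul_tmul, map_sum, mul_one,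
    LinearMap.rTensor_tmul, TensorProduct.lid_tmul] at key
  simp only [LinearMap.comp_apply, LinearMap.mulRight_apply, LinearMap.mulLeft_apply]
  rw [key, sum_antipode_mul_smul_eq hΛ hl hlΛ r (antipode k h)]
  simp_rw [← smul_mul_assoc]
  rw [← Finset.sum_mul, hl.sum_smul r, hlΛ, one_smul, one_mul]

lemma trace_eq_sum_of_integrals (hΛ : IsLeftIntegral k Λ) (hl : IsDualRightIntegral l)
    (hlΛ : l Λ = 1) (r : Repr k Λ ι) (f : H →ₗ[k] H) :
    LinearMap.trace k H f = ∑ i ∈ r.index, l (antipode k (f (r.right i)) * r.left i) := by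
  have hf : f = ∑ i ∈ r.index,
      (l ∘ₗ LinearMap.mulRight k (r.left i) ∘ₗ antipode k ∘ₗ f).smulRight (r.right i) := by
    ext x
    simpa using (sum_antipode_mul_smul_eq hΛ hl hlΛ r (f x)).symm
  conv_lhs => rw [hf]
  simp

/-- The trace formula `Tr(z S²(·)) = ε(Λ) λ(S z)`. -/
lemma trace_mulLeft_comp_antipode_sq (hΛ : IsLeftIntegral k Λ)
    (hΛr : ∀ h : H, Λ * h = (counit h : k) • Λ) (hl : IsDualRightIntegral l)
    (hlΛ : l Λ = 1) (z : H) :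
    LinearMap.trace k H (LinearMap.mulLeft k z ∘ₗ antipode k ∘ₗ antipode k) =
      counit Λ * l (antipode k z) := by
  let r := ℛ k Λ
  rw [trace_eq_sum_of_integrals hΛ hl hlΛ r]
  -- `S(z S²(b)) a = S²(S b) (S(z) a)`, so that the Nakayama automorphism moves `S b` to the right
  have hterm (i : H × H) : l (antipode k ((LinearMap.mulLeft k z ∘ₗ antipode k ∘ₗ antipode k) (r.right i)) *
      r.left i) = l (antipode k z * (r.left i * antipode k (r.right i))) := by
    rw [← mul_assoc, apply_mul_eq_apply_antipode_sq_mul hΛ hΛr hl hlΛ _ (antipode k (r.right i))]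
    simp [antipode_mul_antidistrib, mul_assoc]
  simp_rw [hterm]
  rw [← map_sum, ← Finset.mul_sum, sum_mul_antipode_eq_smul r]
  simp

end Trace

/-! ### Maschke's argument -/

section Maschke

variable {k H : Type*} [Field k] [Ring H] [HopfAlgebra k H]

lemma exists_isLeftIntegral_counit_eq_one [IsSemisimpleRing H] :
    ∃ t : H, IsLeftIntegral k t ∧ counit (R := k) t = 1 := by
  let K : Submodule H H := RingHom.ker (Bialgebra.counitAlgHom k H)
  have hK (x : H) : x ∈ K ↔ counit (R := k) x = 0 := Iff.rfl
  obtain ⟨C, hC⟩ := exists_isCompl K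
  obtain ⟨y, hy, t, ht, hyt⟩ := Submodule.mem_sup.mp (hC.sup_eq_top ▸ Submodule.mem_top (x := 1))
  refine ⟨t, fun h ↦ ?_, ?_⟩
  · -- `(h - ε(h)) t` lies both in the complement and in the kernel of the counit
    rw [← sub_eq_zero, Algebra.smul_def, ← sub_mul]
    refine Submodule.disjoint_def.mp hC.disjoint _ ?_ (C.smul_mem _ ht)
    simp [hK, Bialgebra.counit_mul]
  · have := congr(counit (R := k) $hyt)
    rwa [map_add, (hK y).mp hy, zero_add, Bialgebra.counit_one] at this

lemma IsLeftIntegral.right_and_counit_ne_zero [IsSemisimpleRing H]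
    (hS : Function.Surjective (antipode k : H →ₗ[k] H)) {Λ : H} (hΛ : IsLeftIntegral k Λ)
    (hΛ0 : Λ ≠ 0) :
    (∀ h : H, Λ * h = (counit h : k) • Λ) ∧ counit (R := k) Λ ≠ 0 := by
  obtain ⟨t, ht, ht1⟩ := exists_isLeftIntegral_counit_eq_one (k := k) (H := H)
  have hr (h : H) : antipode k t * h = (counit h : k) • antipode k t := by
    obtain ⟨h, rfl⟩ := hS h
    rw [← antipode_mul_antidistrib, ht, map_smul, counit_antipode]
  -- `S(t)` is a right integral of counit one, so every left integral is a multiple of it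
  have hΛt : Λ = (counit Λ : k) • antipode k t := by
    rw [← hr, hΛ, counit_antipode, ht1, one_smul]
  refine ⟨fun h ↦ ?_, fun h0 ↦ hΛ0 (by rw [hΛt, h0, zero_smul])⟩
  rw [hΛt, smul_mul_assoc, hr, smul_comm]

end Maschke

/-! ### Values on central elements -/

theorem mainTheorem10 {k : Type*} {H : Type*} [Field k] [IsAlgClosed k]
    [Ring H] [HopfAlgebra k H] [Module.Finite k H] [IsSemisimpleRing H]
    (p : ℕ) [CharP k p] (hp : p = 0 ∨ Real.sqrt (Module.finrank k H : ℝ) < (p : ℝ))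
    (Λ : H) (hΛ : IsLeftIntegral k Λ)
    (l : H →ₗ[k] k) (hl : IsDualRightIntegral l) (hlΛ : l Λ = 1)
    (e : H) (he : IsCentralPrimitiveIdempotent e) :
    l e = l (HopfAlgebra.antipode k e) := by
  have hS := antipode_surjective_of_integrals hΛ hl hlΛ
  have hΛ0 : Λ ≠ 0 := by
    rintro rfl
    simp at hlΛ
  obtain ⟨hΛr, hε⟩ := hΛ.right_and_counit_ne_zero hS hΛ0
  have hcomm (x : H) : e * x = x * e := (Set.mem_center_iff.mp he.central).comm x
  have hconj : LinearMap.mulLeft k (antipode k e) ∘ₗ antipode k ∘ₗ antipode k =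
      antipode k ∘ₗ LinearMap.mulLeft k e ∘ₗ antipode k := by
    ext x
    simp only [LinearMap.comp_apply, LinearMap.mulLeft_apply]
    rw [hcomm, antipode_mul_antidistrib]
  have htrace : LinearMap.trace k H (LinearMap.mulLeft k (antipode k e) ∘ₗ antipode k ∘ₗ
      antipode k) = LinearMap.trace k H (LinearMap.mulLeft k e ∘ₗ antipode k ∘ₗ antipode k) := by
    rw [hconj, ← Module.End.mul_eq_comp, LinearMap.trace_mul_comm]
    rfl
  rw [trace_mulLeft_comp_antipode_sq hΛ hΛr hl hlΛ, trace_mulLeft_comp_antipode_sq hΛ hΛr hl hlΛ]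
    at htrace
  have hsq := apply_mul_eq_apply_antipode_sq_mul hΛ hΛr hl hlΛ 1 e
  rw [one_mul, mul_one] at hsq
  rw [hsq]
  exact mul_left_cancel₀ hε htrace
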